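/- For a positive integer $\nu$ let $\omega(\nu)$ denote the number of distinct prime divisors of $\nu$ (so $\omega(1)=0$), and for real $x$ let $\pi(x)$ denote the number of primes $p\le x$. For a positive integer $n$ let $g_1(n)$ be the maximum positive integer $k$ such that $$\omega\Bigl(\prod_{i=1}^{l}(n+i)\Bigr)\ge l\qquad\text{for all } 1\le l\le k .$$ **Theorem.** Let $0<\alpha<\frac12$ and $\delta>0$ be real numbers such that $$\sum_{1\le j\le m^{\alpha}}\left\{\pi\left(\frac{m+m^{\alpha}}{j}\right)-\pi\left(\frac{m}{j}\right)\right\}\ \ge\ \delta\, m^{\alpha}$$ holds for all sufficiently large integers $m$. Put $$\gamma=\max\left(\alpha,\ \frac{1-\delta(1-\alpha)}{2-\delta}\right).$$ Then $\gamma<\frac12$, and $g_1(n)<n^{\gamma}$ for all sufficiently large integers $n$. -/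

import Mathlib

open Filter

/-- The set of positive integers `k` such that `ω((n+1)(n+2)⋯(n+l)) ≥ l` for all `1 ≤ l ≤ k`,
where `ω` counts distinct prime divisors. -/
def g1Set (n : ℕ) : Set ℕ :=
  {k | 0 < k ∧ ∀ l : ℕ, 1 ≤ l → l ≤ k →
    l ≤ ArithmeticFunction.cardDistinctFactors (∏ i ∈ Finset.Icc 1 l, (n + i))}

/-- `g₁(n)` is the maximum of `g1Set n`. For `n ≥ 1` this maximum exists, see
`g1_isGreatest` below. -/
noncomputable def g1 (n : ℕ) : ℕ := sSup (g1Set n)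

/-- The prime counting function of a real variable: the number of primes `p ≤ x`. -/
noncomputable def primePi (x : ℝ) : ℕ := Nat.primeCounting ⌊x⌋₊

/-- The sum of `π((m + m^α)/j) - π(m/j)` over positive integers `j ≤ m^α`. -/
noncomputable def primeIntervalSum (α : ℝ) (m : ℕ) : ℝ :=
  ∑ j ∈ Finset.Icc 1 ⌊(m : ℝ) ^ α⌋₊,
    ((primePi (((m : ℝ) + (m : ℝ) ^ α) / (j : ℝ)) : ℝ) - (primePi ((m : ℝ) / (j : ℝ)) : ℝ))

theorem g1Set_lt (n k : ℕ) (hk : k ∈ g1Set n) : k < n + 4 := by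
  by_contra hlt
  have h := hk.2 (n + 4) (by omega) (by omega)
  rw [ArithmeticFunction.cardDistinctFactors_apply, ← List.card_toFinset] at h
  have hsub : (∏ i ∈ Finset.Icc 1 (n + 4), (n + i)).primeFactorsList.toFinset ⊆
      (Finset.range (n + (n + 4) + 1)).filter Nat.Prime := by
    intro p hp
    have hp' : p ∈ (∏ i ∈ Finset.Icc 1 (n + 4), (n + i)).primeFactorsList := by simpa using hp
    have hpp := Nat.prime_of_mem_primeFactorsList hp'
    obtain ⟨i, hi, hd⟩ := (hpp.prime.dvd_finsetProd_iff _).1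
      (Nat.dvd_of_mem_primeFactorsList hp')
    have hi' := Finset.mem_Icc.1 hi
    have := Nat.le_of_dvd (by omega) hd
    simp only [Finset.mem_filter, Finset.mem_range]
    exact ⟨by omega, hpp⟩
  have h1 := Finset.card_le_card hsub
  rw [← Nat.count_eq_card_filter_range] at h1
  have h2 := Nat.primeCounting'_add_le (a := 2) (k := 3) (by norm_num) (by norm_num) (2 * n + 2)
  have h3 : Nat.primeCounting' 3 = 1 := by decide
  have h4 : Nat.count Nat.Prime (n + (n + 4) + 1) = Nat.primeCounting' (3 + (2 * n + 2)) := by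
    rw [Nat.primeCounting']
    congr 1
    omega
  rw [h3, Nat.totient_two] at h2
  omega

/-- For every positive integer `n` the number `g1 n` is the maximum in the definition. -/
theorem g1_isGreatest (n : ℕ) (hn : 1 ≤ n) : IsGreatest (g1Set n) (g1 n) := by
  have hb : BddAbove (g1Set n) := ⟨n + 4, fun k hk => (g1Set_lt n k hk).le⟩
  have hne : (g1Set n).Nonempty := by
    refine ⟨1, one_pos, fun l h1 h2 => ?_⟩
    obtain rfl : l = 1 := by omega
    have : ArithmeticFunction.cardDistinctFactors (n + 1) ≠ 0 := by
      rw [Ne, ArithmeticFunction.cardDistinctFactors_eq_zero]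
      omega
    simp only [Finset.Icc_self, Finset.prod_singleton]
    omega
  exact ⟨Nat.sSup_mem hne hb, fun k hk => le_csSup hb hk⟩

/-!
Suppose `g₁(n) ≥ n ^ γ` and put `k = ⌈n ^ γ⌉`, so that `(n + 1) ⋯ (n + k)` has at least `k` distinct
prime factors. At least `k - π(k)` of these exceed `k`; such primes do not divide `k!`, so their
product divides `(n + k).choose k`, which is at most about `(e n / k) ^ k`
(`sum_log_largePrimes_le`).

The hypothesis makes this product large. Cutting `(n, n + k]` into blocks of length about `m ^ α`
shows that it contains nearly `δ k` integers `j * p` with `p` prime and `j ≤ (2 n) ^ α`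
(`le_card_smallCofactor`). Each of them has its own prime `p ≥ n / (2 n) ^ α`
(`exists_subset_largePrimes`). The remaining `(1 - δ) k` or so primes exceed `k`. Comparing
logarithms gives `δ (1 - α) + (1 - δ) γ ≤ 1 - γ` up to `O(1 / log n)`, where the choice of `γ`
gives equality. Hence a gain of a large constant factor in each of a positive proportion of the
primes is needed: by Chebyshev's bound only `o(k)` primes lie below `K k`, for any constant `K`, so
nearly all of the remaining primes exceed `K k` (`le_sum_log_largePrimes`). A large `K` then yields
a contradiction (`false_of_log_bounds`).

This uses `δ < 1`, which also makes `α < γ`. It holds because `δ ≥ 1` would force every large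
integer to have the form `j * p` with `j` small, and powers of two do not (`density_lt_one`).
-/

/-! ### Integers with a small cofactor -/

/-- The integers `N ∈ (a, b]` of the form `N = j * p` with `p` prime and `j ≤ s`. -/
noncomputable def smallCofactor (s a b : ℕ) : Finset ℕ :=
  open Classical in
  (Finset.Ioc a b).filter (fun N => ∃ j p : ℕ, p.Prime ∧ j ≤ s ∧ N = j * p)

theorem mem_smallCofactor {s a b N : ℕ} :
    N ∈ smallCofactor s a b ↔
      (a < N ∧ N ≤ b) ∧ ∃ j p : ℕ, p.Prime ∧ j ≤ s ∧ N = j * p := by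
  simp [smallCofactor]

theorem smallCofactor_mono_left {s s' a b : ℕ} (h : s ≤ s') :
    smallCofactor s a b ⊆ smallCofactor s' a b := by
  intro N hN
  rw [mem_smallCofactor] at hN ⊢
  obtain ⟨hab, j, p, hp, hj, e⟩ := hN
  exact ⟨hab, j, p, hp, hj.trans h, e⟩

theorem card_smallCofactor_add_le {s a b c : ℕ} (hab : a ≤ b) (hbc : b ≤ c) :
    (smallCofactor s a b).card + (smallCofactor s b c).card ≤ (smallCofactor s a c).card := by
  rw [← Finset.card_union_of_disjoint]
  · apply Finset.card_le_card
    intro N hN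
    rw [Finset.mem_union, mem_smallCofactor, mem_smallCofactor] at hN
    rw [mem_smallCofactor]
    rcases hN with ⟨h, h'⟩ | ⟨h, h'⟩
    · exact ⟨by omega, h'⟩
    · exact ⟨by omega, h'⟩
  · rw [Finset.disjoint_left]
    intro N h1 h2
    rw [mem_smallCofactor] at h1 h2
    omega

theorem primeCounting_sub_eq_card {a b : ℕ} (hab : a ≤ b) :
    (Nat.primeCounting b : ℝ) - Nat.primeCounting a =
      ((Finset.Ioc a b).filter Nat.Prime).card := by
  rw [sub_eq_iff_eq_add, ← Nat.cast_add, Nat.cast_inj, ← Nat.primesLE_card_eq_primeCounting,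
    ← Nat.primesLE_card_eq_primeCounting, ← Finset.card_union_of_disjoint]
  · congr 1
    ext p
    simp only [Nat.mem_primesLE, Finset.mem_union, Finset.mem_filter, Finset.mem_Ioc]
    constructor
    · rintro ⟨h1, h2⟩
      by_cases h : p ≤ a
      · exact Or.inr ⟨h, h2⟩
      · exact Or.inl ⟨⟨by omega, h1⟩, h2⟩
    · rintro (⟨h1, h2⟩ | ⟨h1, h2⟩)
      · exact ⟨h1.2, h2⟩
      · exact ⟨h1.trans hab, h2⟩
  · rw [Finset.disjoint_left]
    intro p h1 h2
    simp only [Nat.mem_primesLE, Finset.mem_filter, Finset.mem_Ioc] at h1 h2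
    omega

/-- A representation `N = j * p` with `j ≤ s` and `s ^ 2 ≤ m < N` is unique, because both primes
exceed `s`; so counting pairs `(j, p)` is the same as counting integers. -/
theorem sum_primeCounting_sub_le {s m : ℕ} (hs : s * s ≤ m) :
    ∑ j ∈ Finset.Icc 1 s,
        ((Nat.primeCounting ((m + s) / j) : ℝ) - Nat.primeCounting (m / j)) ≤
      (smallCofactor s m (m + s)).card := by
  have e : ∀ j ∈ Finset.Icc 1 s,
      ((Nat.primeCounting ((m + s) / j) : ℝ) - Nat.primeCounting (m / j)) =
        (((Finset.Ioc (m / j) ((m + s) / j)).filter Nat.Prime).card : ℕ) := fun j _ =>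
    primeCounting_sub_eq_card (Nat.div_le_div_right (Nat.le_add_right m s))
  rw [Finset.sum_congr rfl e, ← Nat.cast_sum, Nat.cast_le, ← Finset.card_sigma]
  have key : ∀ x ∈ (Finset.Icc 1 s).sigma
      (fun j => (Finset.Ioc (m / j) ((m + s) / j)).filter Nat.Prime),
      0 < x.1 ∧ x.1 ≤ s ∧ m < x.1 * x.2 ∧ x.1 * x.2 ≤ m + s ∧ x.2.Prime ∧ s < x.2 := by
    rintro ⟨j, p⟩ hx
    simp only [Finset.mem_sigma, Finset.mem_Icc, Finset.mem_filter, Finset.mem_Ioc] at hx ⊢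
    obtain ⟨⟨hj1, hj2⟩, ⟨h1, h2⟩, hp⟩ := hx
    have h1' : m < j * p := by
      rw [mul_comm]; exact (Nat.div_lt_iff_lt_mul hj1).1 h1
    have h2' : j * p ≤ m + s := by
      rw [mul_comm]; exact (Nat.le_div_iff_mul_le hj1).1 h2
    refine ⟨hj1, hj2, h1', h2', hp, ?_⟩
    by_contra hle
    have := Nat.mul_le_mul hj2 (not_lt.1 hle)
    omega
  refine Finset.card_le_card_of_injOn (fun x => x.1 * x.2) ?_ ?_
  · intro x hx
    obtain ⟨_, h2, h3, h4, h5, _⟩ := key x hx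
    exact mem_smallCofactor.2 ⟨⟨h3, h4⟩, x.1, x.2, h5, h2, rfl⟩
  · intro x hx y hy hxy
    obtain ⟨jx, px⟩ := x
    obtain ⟨jy, py⟩ := y
    obtain ⟨hx1, hx2, _, _, hx5, hx6⟩ := key _ hx
    obtain ⟨hy1, hy2, _, _, hy5, hy6⟩ := key _ hy
    simp only at hx1 hx2 hx5 hx6 hy1 hy2 hy5 hy6 hxy
    have hd : py ∣ jx * px := hxy ▸ dvd_mul_left py jy
    rcases (Nat.Prime.dvd_mul hy5).1 hd with h | h
    · have := Nat.le_of_dvd hx1 h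
      omega
    · obtain rfl := (Nat.prime_dvd_prime_iff_eq hy5 hx5).1 h
      obtain rfl := Nat.eq_of_mul_eq_mul_right hx5.pos hxy
      rfl

/-! ### Consequences of the density hypothesis -/

theorem floor_rpow_mul_self_le {α : ℝ} (hα : α < 1 / 2) {m : ℕ} (hm : 1 ≤ m) :
    ⌊(m : ℝ) ^ α⌋₊ * ⌊(m : ℝ) ^ α⌋₊ ≤ m := by
  have hm' : (1 : ℝ) ≤ m := by exact_mod_cast hm
  have h0 : (0 : ℝ) ≤ (m : ℝ) ^ α := by positivity
  have h1 : (⌊(m : ℝ) ^ α⌋₊ : ℝ) ≤ (m : ℝ) ^ α := Nat.floor_le h0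
  have h2 : (m : ℝ) ^ α * (m : ℝ) ^ α ≤ m := by
    rw [← Real.rpow_add (by linarith)]
    calc (m : ℝ) ^ (α + α) ≤ (m : ℝ) ^ (1 : ℝ) :=
          Real.rpow_le_rpow_of_exponent_le hm' (by linarith)
      _ = m := Real.rpow_one _
  have h3 : (⌊(m : ℝ) ^ α⌋₊ : ℝ) * ⌊(m : ℝ) ^ α⌋₊ ≤ m :=
    (mul_le_mul h1 h1 (Nat.cast_nonneg _) h0).trans h2
  exact_mod_cast h3

theorem primeIntervalSum_le_card {α : ℝ} (hα : α < 1 / 2) {m : ℕ} (hm : 1 ≤ m) :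
    primeIntervalSum α m ≤
      (smallCofactor ⌊(m : ℝ) ^ α⌋₊ m (m + ⌊(m : ℝ) ^ α⌋₊)).card := by
  refine le_trans (le_of_eq ?_) (sum_primeCounting_sub_le (floor_rpow_mul_self_le hα hm))
  unfold primeIntervalSum primePi
  refine Finset.sum_congr rfl fun j _ => ?_
  rw [Nat.floor_div_natCast, Nat.floor_div_natCast, Nat.floor_natCast,
    add_comm, Nat.floor_add_natCast (by positivity), add_comm]

/-- A hypothesis with `δ ≥ 1` would force every large integer to be of the form `j * p` with `j`
small, which fails for powers of two. -/
theorem density_lt_one {α δ : ℝ} (hα0 : 0 < α) (hα : α < 1 / 2)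
    (h : ∀ᶠ m : ℕ in atTop, δ * (m : ℝ) ^ α ≤ primeIntervalSum α m) : δ < 1 := by
  have hs : Tendsto (fun m : ℕ => ⌊(m : ℝ) ^ α⌋₊) atTop atTop :=
    tendsto_nat_floor_atTop.comp ((tendsto_rpow_atTop hα0).comp tendsto_natCast_atTop_atTop)
  have ht : Tendsto (fun t : ℕ => 2 ^ t - 1) atTop atTop :=
    (tendsto_sub_atTop_nat 1).comp (tendsto_pow_atTop_atTop_of_one_lt (by norm_num))
  obtain ⟨t, h1, h2, h3⟩ := (ht.eventually
    (h.and ((hs.eventually_ge_atTop 2).and (eventually_ge_atTop 1)))).exists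
  set m := 2 ^ t - 1 with hm
  have hmt : 2 ^ t = m + 1 := by
    have := Nat.one_le_two_pow (n := t)
    omega
  set s := ⌊(m : ℝ) ^ α⌋₊ with hsdef
  have hsq : s * s ≤ m := floor_rpow_mul_self_le hα h3
  have hsub : smallCofactor s m (m + s) ⊆ (Finset.Ioc m (m + s)).erase (m + 1) := by
    intro N hN
    rw [mem_smallCofactor] at hN
    obtain ⟨hN1, j, p, hp, hj, e⟩ := hN
    rw [Finset.mem_erase, Finset.mem_Ioc]
    refine ⟨?_, hN1⟩
    intro hN2
    have hp2 : p ∣ 2 ^ t := by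
      rw [hmt, ← hN2, e]
      exact dvd_mul_left p j
    have hp2' : p = 2 := (Nat.prime_dvd_prime_iff_eq hp Nat.prime_two).1 (hp.dvd_of_dvd_pow hp2)
    have : j * p ≤ s * s := Nat.mul_le_mul hj (by omega)
    omega
  have hc := Finset.card_le_card hsub
  rw [Finset.card_erase_of_mem (by rw [Finset.mem_Ioc]; omega), Nat.card_Ioc] at hc
  have hc' : (smallCofactor s m (m + s)).card + 1 ≤ s := by omega
  have hc2 : ((smallCofactor s m (m + s)).card : ℝ) + 1 ≤ s := by exact_mod_cast hc'
  have hle : (s : ℝ) ≤ (m : ℝ) ^ α := Nat.floor_le (by positivity)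
  have h4 := primeIntervalSum_le_card hα h3
  have hpos : (0 : ℝ) < (m : ℝ) ^ α := by
    have : (0 : ℝ) < m := by exact_mod_cast h3
    positivity
  by_contra hδ
  nlinarith [mul_le_mul_of_nonneg_right (not_lt.1 hδ) hpos.le]

/-- Cutting `(a, b]` into blocks `(m, m + ⌊m ^ α⌋]` transfers the hypothesis to long intervals;
the incomplete last block costs at most `J`. -/
theorem le_card_smallCofactor {α δ : ℝ} (hα0 : 0 < α) (hα : α < 1 / 2) (hδ : 0 < δ) {J b : ℕ}
    (hJ : J = ⌊(b : ℝ) ^ α⌋₊) {M : ℕ} (hM : 1 ≤ M)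
    (h : ∀ m : ℕ, M ≤ m → δ * (m : ℝ) ^ α ≤ primeIntervalSum α m) {c : ℕ} (hcb : c ≤ b)
    (d a : ℕ) (ha : M ≤ a) (hac : a + d = c) :
    δ * ((d : ℝ) - J) ≤ (smallCofactor J a c).card := by
  induction d using Nat.strong_induction_on generalizing a with
  | _ d ih =>
    have ha1 : (1 : ℝ) ≤ a := by exact_mod_cast hM.trans ha
    set s := ⌊(a : ℝ) ^ α⌋₊ with hs
    have hsJ : s ≤ J := by
      rw [hJ]
      refine Nat.floor_le_floor (Real.rpow_le_rpow (by positivity) ?_ hα0.le)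
      exact_mod_cast (by omega : a ≤ b)
    have hs1 : 1 ≤ s := Nat.le_floor (by
      rw [Nat.cast_one]
      exact Real.one_le_rpow ha1 hα0.le)
    have hsa : (s : ℝ) ≤ (a : ℝ) ^ α := Nat.floor_le (by positivity)
    by_cases hds : d < s
    · have : (d : ℝ) - J ≤ 0 := by
        have : (d : ℝ) ≤ J := by exact_mod_cast (by omega : d ≤ J)
        linarith
      exact (mul_nonpos_of_nonneg_of_nonpos hδ.le this).trans (Nat.cast_nonneg _)
    · have h1 := ih (d - s) (by omega) (a + s) (by omega) (by omega)
      have h2 : δ * (s : ℝ) ≤ (smallCofactor J a (a + s)).card := by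
        calc δ * (s : ℝ) ≤ δ * (a : ℝ) ^ α := by gcongr
          _ ≤ _ := (h a ha).trans (primeIntervalSum_le_card hα (hM.trans ha))
          _ ≤ _ := by exact_mod_cast Finset.card_le_card (smallCofactor_mono_left hsJ)
      have h3 : ((smallCofactor J a (a + s)).card : ℝ) + (smallCofactor J (a + s) c).card ≤
          (smallCofactor J a c).card := by
        exact_mod_cast card_smallCofactor_add_le (by omega) (by omega)
      rw [Nat.cast_sub (by omega)] at h1
      linarith

/-! ### Prime factors of `(n + 1) ⋯ (n + k)` exceeding `k` -/

/-- The primes exceeding `k` that divide `(n + 1) ⋯ (n + k)`. Since they do not divide `k!`, they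
are encoded as prime factors of the binomial coefficient `(n + k).choose k`. -/
noncomputable def largePrimes (n k : ℕ) : Finset ℕ :=
  ((n + k).choose k).primeFactors.filter (k < ·)

theorem prod_Icc_add_eq (n k : ℕ) :
    ∏ i ∈ Finset.Icc 1 k, (n + i) = k.factorial * (n + k).choose k := by
  rw [← Nat.ascFactorial_eq_factorial_mul_choose]
  induction k with
  | zero => simp
  | succ k ih =>
    rw [Finset.prod_Icc_succ_top (by omega), ih, Nat.ascFactorial_succ]
    ring

theorem mem_largePrimes {n k p i : ℕ} (hp : p.Prime) (hk : k < p) (hi : i ∈ Finset.Icc 1 k)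
    (hd : p ∣ n + i) : p ∈ largePrimes n k := by
  have h1 : p ∣ k.factorial * (n + k).choose k :=
    prod_Icc_add_eq n k ▸ hd.trans (Finset.dvd_prod_of_mem (fun i => n + i) hi)
  have h2 : p ∣ (n + k).choose k := by
    rcases (Nat.Prime.dvd_mul hp).1 h1 with h | h
    · have := (Nat.Prime.dvd_factorial hp).1 h
      omega
    · exact h
  exact Finset.mem_filter.2
    ⟨Nat.mem_primeFactors.2 ⟨hp, h2, (Nat.choose_pos (Nat.le_add_left k n)).ne'⟩, hk⟩

theorem cardDistinctFactors_prod_le (n k : ℕ) :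
    ArithmeticFunction.cardDistinctFactors (∏ i ∈ Finset.Icc 1 k, (n + i)) ≤
      Nat.primeCounting k + (largePrimes n k).card := by
  rw [ArithmeticFunction.cardDistinctFactors_apply, ← List.card_toFinset,
    ← Nat.primesLE_card_eq_primeCounting]
  refine le_trans (Finset.card_le_card ?_) (Finset.card_union_le _ _)
  intro p hp
  have hp' : p ∈ (∏ i ∈ Finset.Icc 1 k, (n + i)).primeFactorsList := by simpa using hp
  have hpp := Nat.prime_of_mem_primeFactorsList hp'
  rw [Finset.mem_union, Nat.mem_primesLE]
  by_cases hk : p ≤ k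
  · exact Or.inl ⟨hk, hpp⟩
  · obtain ⟨i, hi, hd⟩ := (hpp.prime.dvd_finsetProd_iff _).1 (Nat.dvd_of_mem_primeFactorsList hp')
    exact Or.inr (mem_largePrimes hpp (not_le.1 hk) hi hd)

theorem sum_log_largePrimes_le {n k : ℕ} (hk : 1 ≤ k) (hkn : k ≤ n) :
    ∑ p ∈ largePrimes n k, Real.log p ≤ k * (Real.log n + 2 - Real.log k) := by
  have hk0 : (0 : ℝ) < k := by exact_mod_cast hk
  have hn0 : (0 : ℝ) < n := by exact_mod_cast hk.trans hkn
  have hC : 0 < (n + k).choose k := Nat.choose_pos (Nat.le_add_left k n)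
  have hd : ∏ p ∈ largePrimes n k, p ≤ (n + k).choose k :=
    Nat.le_of_dvd hC ((Finset.prod_dvd_prod_of_subset _ _ _ (Finset.filter_subset _ _)).trans
      (Nat.prod_primeFactors_dvd _))
  have hpos : ∀ p ∈ largePrimes n k, (p : ℝ) ≠ 0 := by
    intro p hp
    have := (Finset.mem_filter.1 hp).2
    exact_mod_cast (by omega : p ≠ 0)
  have hfac : (0 : ℝ) < (k.factorial : ℝ) := by exact_mod_cast Nat.factorial_pos k
  have h1 : (((n + k).choose k : ℕ) : ℝ) ≤ ((n + k : ℕ) : ℝ) ^ k / (k.factorial : ℝ) :=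
    Nat.choose_le_pow_div k (n + k)
  have h2 : (k : ℝ) ^ k / (k.factorial : ℝ) ≤ Real.exp k :=
    Real.pow_div_factorial_le_exp _ hk0.le k
  have h3 : k * Real.log k - Real.log k.factorial ≤ k := by
    have := Real.log_le_log (by positivity) h2
    rwa [Real.log_exp, Real.log_div (by positivity) hfac.ne', Real.log_pow] at this
  have h4 : Real.log ((n + k : ℕ) : ℝ) ≤ Real.log n + 1 := by
    have h5 : ((n + k : ℕ) : ℝ) ≤ n * 2 := by exact_mod_cast (by omega : n + k ≤ n * 2)
    have h6 := Real.log_le_log (by positivity) h5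
    rw [Real.log_mul hn0.ne' (by norm_num)] at h6
    linarith [Real.log_two_lt_d9]
  calc ∑ p ∈ largePrimes n k, Real.log p
      = Real.log ((∏ p ∈ largePrimes n k, p : ℕ) : ℝ) := by
        rw [Nat.cast_prod, Real.log_prod hpos]
    _ ≤ Real.log (((n + k : ℕ) : ℝ) ^ k / (k.factorial : ℝ)) := by
        refine Real.log_le_log ?_ (le_trans (by exact_mod_cast hd) h1)
        rw [Nat.cast_prod]
        exact Finset.prod_pos fun p hp => lt_of_le_of_ne (Nat.cast_nonneg p) (hpos p hp).symm
    _ = k * Real.log ((n + k : ℕ) : ℝ) - Real.log k.factorial := by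
        rw [Real.log_div (by positivity) hfac.ne', Real.log_pow]
    _ ≤ k * (Real.log n + 2 - Real.log k) := by
        nlinarith [mul_le_mul_of_nonneg_left h4 hk0.le]

/-- Every integer `j * p ∈ (n, n + k]` with `j ≤ J` contributes its own prime `p > n / J`. -/
theorem exists_subset_largePrimes {n k J : ℕ} (hJk : J * k ≤ n) :
    ∃ A ⊆ largePrimes n k, A.card = (smallCofactor J n (n + k)).card ∧ ∀ p ∈ A, n < J * p := by
  have hex : ∀ N : ℕ, ∃ p : ℕ, N ∈ smallCofactor J n (n + k) → p.Prime ∧ p ∣ N ∧ n < J * p := by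
    intro N
    by_cases hN : N ∈ smallCofactor J n (n + k)
    · obtain ⟨⟨hN1, _⟩, j, p, hp, hj, e⟩ := mem_smallCofactor.1 hN
      exact ⟨p, fun _ => ⟨hp, e ▸ dvd_mul_left p j,
        hN1.trans_le (e ▸ Nat.mul_le_mul_right p hj)⟩⟩
    · exact ⟨0, fun h => absurd h hN⟩
  choose f hf using hex
  have hlt : ∀ N ∈ smallCofactor J n (n + k), k < f N := by
    intro N hN
    have h1 := (hf N hN).2.2
    by_contra hle
    have := Nat.mul_le_mul_left J (not_lt.1 hle)
    omega
  refine ⟨(smallCofactor J n (n + k)).image f, ?_, ?_, ?_⟩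
  · intro p hp
    obtain ⟨N, hN, rfl⟩ := Finset.mem_image.1 hp
    have hI := (mem_smallCofactor.1 hN).1
    refine mem_largePrimes (hf N hN).1 (hlt N hN) (i := N - n)
      (Finset.mem_Icc.2 (by omega)) ?_
    rw [Nat.add_sub_cancel' hI.1.le]
    exact (hf N hN).2.1
  · refine Finset.card_image_of_injOn fun x hx y hy hxy => ?_
    have hx1 := (mem_smallCofactor.1 hx).1
    have hy1 := (mem_smallCofactor.1 hy).1
    have hxd := (hf x hx).2.1
    have hyd := (hf y hy).2.1
    have hk := hlt x hx
    rw [← hxy] at hyd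
    rcases lt_trichotomy x y with h | h | h
    · have := Nat.le_of_dvd (by omega) (Nat.dvd_sub hyd hxd)
      omega
    · exact h
    · have := Nat.le_of_dvd (by omega) (Nat.dvd_sub hxd hyd)
      omega
  · intro p hp
    obtain ⟨N, hN, rfl⟩ := Finset.mem_image.1 hp
    exact (hf N hN).2.2

/-- Lower bound for the sum of `log p` over `largePrimes n k`: the primes in `A` weigh at least `y`,
all others at least `log k`, and those others above `K * k` at least `log k + log K`. -/
theorem le_sum_log_largePrimes {n k K : ℕ} (hk : 1 ≤ k) (hK : 1 ≤ K) {A : Finset ℕ}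
    (hA : A ⊆ largePrimes n k) {y : ℝ} (hy : ∀ p ∈ A, y ≤ Real.log p) :
    A.card * y + ((largePrimes n k).card - A.card) * (Real.log k + Real.log K)
        - Nat.primeCounting (K * k) * Real.log K ≤
      ∑ p ∈ largePrimes n k, Real.log p := by
  have hk0 : (0 : ℝ) < k := by exact_mod_cast hk
  have hK1 : (1 : ℝ) ≤ K := by exact_mod_cast hK
  have hL : 0 ≤ Real.log K := Real.log_nonneg hK1
  have hmem : ∀ p ∈ largePrimes n k, p.Prime ∧ k < p := fun p hp =>
    ⟨Nat.prime_of_mem_primeFactors (Finset.mem_filter.1 hp).1, (Finset.mem_filter.1 hp).2⟩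
  have h1 : (A.card : ℝ) * y ≤ ∑ p ∈ A, Real.log p := by
    rw [← nsmul_eq_mul]
    exact Finset.card_nsmul_le_sum _ _ _ hy
  have h2 : ∑ p ∈ largePrimes n k \ A,
      ((Real.log k + Real.log K) - if p ≤ K * k then Real.log K else 0) ≤
      ∑ p ∈ largePrimes n k \ A, Real.log p := by
    refine Finset.sum_le_sum fun p hp => ?_
    obtain ⟨_, hkp⟩ := hmem p (Finset.mem_sdiff.1 hp).1
    split_ifs with h
    · have : Real.log k ≤ Real.log p := Real.log_le_log hk0 (by exact_mod_cast hkp.le)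
      linarith
    · have h3 : (K : ℝ) * k ≤ p := by exact_mod_cast (not_le.1 h).le
      have := Real.log_le_log (by positivity) h3
      rw [Real.log_mul (by positivity) hk0.ne'] at this
      linarith
  rw [Finset.sum_sub_distrib, Finset.sum_const, nsmul_eq_mul, Finset.card_sdiff_of_subset hA,
    Nat.cast_sub (Finset.card_le_card hA), ← Finset.sum_filter, Finset.sum_const,
    nsmul_eq_mul] at h2
  have h3 : (((largePrimes n k \ A).filter (· ≤ K * k)).card : ℝ) ≤
      Nat.primeCounting (K * k) := by
    rw [← Nat.primesLE_card_eq_primeCounting, Nat.cast_le]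
    refine Finset.card_le_card fun p hp => ?_
    obtain ⟨hp1, hp2⟩ := Finset.mem_filter.1 hp
    exact Nat.mem_primesLE.2 ⟨hp2, (hmem p (Finset.mem_sdiff.1 hp1).1).1⟩
  have h4 := mul_le_mul_of_nonneg_right h3 hL
  rw [← Finset.sum_sdiff hA]
  linarith

/-! ### Asymptotic estimates -/

/-- Chebyshev's upper bound, with a constant that is convenient rather than sharp. -/
theorem eventually_primeCounting_mul_log_le :
    ∀ᶠ x : ℕ in atTop, (Nat.primeCounting x : ℝ) * Real.log x ≤ 3 * x := by
  have h := Chebyshev.eventually_primeCounting_le (ε := 1) one_pos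
  filter_upwards [tendsto_natCast_atTop_atTop.eventually h, eventually_ge_atTop 2] with x hx hx2
  have hlog : 0 < Real.log x := Real.log_pos (by exact_mod_cast hx2)
  rw [Nat.floor_natCast, le_div_iff₀ hlog] at hx
  have h4 : Real.log 4 ≤ 2 := by
    rw [show (4 : ℝ) = 2 ^ 2 by norm_num, Real.log_pow]
    push_cast
    linarith [Real.log_two_lt_d9]
  have : (0 : ℝ) ≤ x := Nat.cast_nonneg x
  nlinarith

theorem eventually_primeCounting_le_mul {ε : ℝ} (hε : 0 < ε) :
    ∀ᶠ x : ℕ in atTop, (Nat.primeCounting x : ℝ) ≤ ε * x := by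
  have hlog : Tendsto (fun x : ℕ => Real.log x) atTop atTop :=
    Real.tendsto_log_atTop.comp tendsto_natCast_atTop_atTop
  filter_upwards [eventually_primeCounting_mul_log_le, hlog.eventually_ge_atTop (3 / ε),
    eventually_ge_atTop 2] with x hx h1 h2
  have hpos : 0 < Real.log x := Real.log_pos (by exact_mod_cast h2)
  rw [div_le_iff₀ hε] at h1
  refine le_of_mul_le_mul_right (hx.trans ?_) hpos
  have : (0 : ℝ) ≤ x := Nat.cast_nonneg x
  nlinarith

theorem eventually_const_mul_rpow_mul_log_le {a b : ℝ} (hab : a < b) (C : ℝ) :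
    ∀ᶠ n : ℕ in atTop, C * (n : ℝ) ^ a * Real.log n ≤ (n : ℝ) ^ b := by
  have h := (isLittleO_log_rpow_atTop (sub_pos.2 hab)).bound
    (show (0 : ℝ) < 1 / (|C| + 1) by positivity)
  filter_upwards [tendsto_natCast_atTop_atTop.eventually h, eventually_ge_atTop 1] with n hn h1
  have h1' : (1 : ℝ) ≤ n := by exact_mod_cast h1
  have hn0 : (0 : ℝ) < n := by linarith
  have hl : 0 ≤ Real.log n := Real.log_nonneg h1'
  rw [Real.norm_of_nonneg hl, Real.norm_of_nonneg (by positivity), div_mul_eq_mul_div, one_mul,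
    le_div_iff₀ (by positivity)] at hn
  have h2 : C * Real.log n ≤ (n : ℝ) ^ (b - a) := by
    nlinarith [le_abs_self C]
  calc C * (n : ℝ) ^ a * Real.log n = (n : ℝ) ^ a * (C * Real.log n) := by ring
    _ ≤ (n : ℝ) ^ a * (n : ℝ) ^ (b - a) := by gcongr
    _ = (n : ℝ) ^ b := by rw [← Real.rpow_add hn0]; ring_nf

/-! ### Comparison of logarithms -/

/-- The numerical contradiction. Here `β = log n`, `l = log k`, `L = log K`, `c` is the number of
primes in `largePrimes n k`, `a` the size of a set of such primes all at least `exp y`, `u = π(k)`,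
`v = π(K k)`, and `S` is the sum of the logarithms. With `l ≥ γ β` all terms of order `k β` cancel;
what remains is `(1 - δ) / 2 * L ≤ 7`. -/
theorem false_of_log_bounds {α δ γ β k l L J y c a u v S : ℝ} (hk : 0 < k) (hδ0 : 0 < δ)
    (hδ1 : δ < 1) (hγ : γ * (2 - δ) = 1 - δ * (1 - α)) (hS : S ≤ k * (β + 2 - l))
    (hS' : a * y + (c - a) * (l + L) - v * L ≤ S) (ha : δ * (k - J) ≤ a) (hc : k ≤ u + c)
    (hly : l + L ≤ y) (hy : (1 - α) * β - 1 ≤ y) (hyβ : y ≤ β) (hJ0 : 0 ≤ J) (hJ : J * β ≤ k)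
    (hl0 : 0 ≤ l) (hL0 : 0 ≤ L) (hu : u * l ≤ 3 * k) (huv : u + v ≤ (1 - δ) / 2 * k)
    (hl : γ * β ≤ l) (hL : 16 ≤ L * (1 - δ)) : False := by
  have h1 := mul_le_mul_of_nonneg_right ha (sub_nonneg.2 hly)
  have h2 : J * (y - (l + L)) ≤ k := le_trans (by gcongr; linarith) hJ
  have h3 : δ * (J * (y - (l + L))) ≤ δ * k := by gcongr
  have h4 : δ * k * ((1 - α) * β - 1 - (l + L)) ≤ δ * k * (y - (l + L)) := by gcongr
  have h5 := mul_le_mul_of_nonneg_right hc (add_nonneg hl0 hL0)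
  have h6 := mul_le_mul_of_nonneg_right huv hL0
  have h7 : γ * β * (2 - δ) ≤ l * (2 - δ) := mul_le_mul_of_nonneg_right hl (by linarith)
  have h8 : (1 - δ * (1 - α)) * β ≤ l * (2 - δ) := by rw [← hγ]; linarith
  have h9 : k * ((1 - δ * (1 - α)) * β) ≤ k * (l * (2 - δ)) := by gcongr
  have h10 : k * 16 ≤ k * (L * (1 - δ)) := by gcongr
  have h11 : δ * k < 1 * k := by gcongr
  linarith

theorem mainTheorem3 (α δ : ℝ) (hα0 : 0 < α) (hα : α < 1 / 2) (hδ : 0 < δ)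
    (h : ∀ᶠ m : ℕ in atTop, δ * (m : ℝ) ^ α ≤ primeIntervalSum α m) :
    max α ((1 - δ * (1 - α)) / (2 - δ)) < 1 / 2 ∧
      ∀ᶠ n : ℕ in atTop,
        (g1 n : ℝ) < (n : ℝ) ^ (max α ((1 - δ * (1 - α)) / (2 - δ))) := by
  have hδ1 : δ < 1 := density_lt_one hα0 hα h
  have h2δ : 0 < 2 - δ := by linarith
  set γ := (1 - δ * (1 - α)) / (2 - δ) with hγdef
  have hγ : γ * (2 - δ) = 1 - δ * (1 - α) := div_mul_cancel₀ _ h2δ.ne'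
  have hαγ : α < γ := by
    rw [hγdef, lt_div_iff₀ h2δ]
    nlinarith [mul_pos (sub_pos.2 hδ1) (sub_pos.2 hα)]
  have hγ2 : γ < 1 / 2 := by
    rw [hγdef, div_lt_iff₀ h2δ]
    nlinarith [mul_pos hδ (sub_pos.2 hα)]
  have hγ0 : 0 < γ := hα0.trans hαγ
  rw [max_eq_right hαγ.le]
  refine ⟨hγ2, ?_⟩
  obtain ⟨M, hM⟩ := eventually_atTop.1 h
  -- `K` is chosen so that `(1 - δ) * log K` exceeds every bounded error term.
  set K := ⌈Real.exp (16 / (1 - δ))⌉₊ with hKdef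
  have hKexp : Real.exp (16 / (1 - δ)) ≤ K := Nat.le_ceil _
  have hK1 : 1 ≤ K := Nat.one_le_ceil_iff.2 (Real.exp_pos _)
  have hK0 : (0 : ℝ) < K := by exact_mod_cast hK1
  have hL : 16 ≤ Real.log K * (1 - δ) := by
    rw [← div_le_iff₀ (by linarith), Real.le_log_iff_exp_le hK0]
    exact hKexp
  have hη : 0 < (1 - δ) / 4 := by linarith
  have hk_top : Tendsto (fun n : ℕ => ⌈(n : ℝ) ^ γ⌉₊) atTop atTop :=
    tendsto_nat_ceil_atTop.comp ((tendsto_rpow_atTop hγ0).comp tendsto_natCast_atTop_atTop)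
  have hKk_top : Tendsto (fun k : ℕ => K * k) atTop atTop :=
    tendsto_id.const_mul_atTop' (by omega)
  have hlog_top : Tendsto (fun n : ℕ => Real.log n) atTop atTop :=
    Real.tendsto_log_atTop.comp tendsto_natCast_atTop_atTop
  filter_upwards [hk_top.eventually eventually_primeCounting_mul_log_le,
    hk_top.eventually (eventually_primeCounting_le_mul hη),
    hk_top.eventually (hKk_top.eventually (eventually_primeCounting_le_mul
      (div_pos hη hK0))),
    eventually_const_mul_rpow_mul_log_le hαγ 2,
    eventually_const_mul_rpow_mul_log_le (show α + γ < 1 by linarith) (4 * K),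
    hlog_top.eventually_ge_atTop 1, eventually_ge_atTop 1, eventually_ge_atTop M]
    with n hπ1 hπ2 hπ3 hJlog hKJk hβ hn1 hnM
  by_contra hcon
  set k := ⌈(n : ℝ) ^ γ⌉₊ with hkdef
  set J := ⌊((2 * n : ℕ) : ℝ) ^ α⌋₊ with hJdef
  have hn1' : (1 : ℝ) ≤ n := by exact_mod_cast hn1
  have hn0 : (0 : ℝ) < n := by linarith
  have hnγ1 : 1 ≤ (n : ℝ) ^ γ := Real.one_le_rpow hn1' hγ0.le
  have hkγ : (n : ℝ) ^ γ ≤ k := Nat.le_ceil _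
  have hk1 : 1 ≤ k := Nat.one_le_ceil_iff.2 (by linarith)
  have hk0 : (0 : ℝ) < k := by exact_mod_cast hk1
  have hk2 : (k : ℝ) ≤ 2 * (n : ℝ) ^ γ := by
    have := Nat.ceil_lt_add_one (show 0 ≤ (n : ℝ) ^ γ by positivity)
    linarith
  have h2n : ((2 * n : ℕ) : ℝ) = 2 * n := by push_cast; ring
  have hJle : (J : ℝ) ≤ ((2 * n : ℕ) : ℝ) ^ α := Nat.floor_le (by positivity)
  have hJ1 : 1 ≤ J := Nat.le_floor (by
    rw [Nat.cast_one]
    exact Real.one_le_rpow (by rw [h2n]; linarith) hα0.le)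
  have hJ0 : (0 : ℝ) < J := by exact_mod_cast hJ1
  have hJ2 : (J : ℝ) ≤ 2 * (n : ℝ) ^ α := by
    refine hJle.trans ?_
    rw [h2n, Real.mul_rpow (by norm_num) hn0.le]
    gcongr
    calc (2 : ℝ) ^ α ≤ 2 ^ (1 : ℝ) :=
          Real.rpow_le_rpow_of_exponent_le (by norm_num) (by linarith)
      _ = 2 := Real.rpow_one 2
  have hJβ : (J : ℝ) * Real.log n ≤ k := by
    refine le_trans ?_ (hJlog.trans hkγ)
    gcongr
  have hprodR : (J : ℝ) * (k * K) ≤ n := by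
    have h1 : (J : ℝ) * (k * K) ≤ 2 * (n : ℝ) ^ α * (2 * (n : ℝ) ^ γ * K) := by gcongr
    have h2 : 2 * (n : ℝ) ^ α * (2 * (n : ℝ) ^ γ * K) = 4 * K * (n : ℝ) ^ (α + γ) := by
      rw [Real.rpow_add hn0]; ring
    have h3 : 4 * K * (n : ℝ) ^ (α + γ) ≤ 4 * K * (n : ℝ) ^ (α + γ) * Real.log n :=
      le_mul_of_one_le_right (by positivity) hβ
    rw [Real.rpow_one] at hKJk
    linarith
  have hprod : J * (k * K) ≤ n := by exact_mod_cast hprodR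
  have hJk : J * k ≤ n := le_trans (Nat.mul_le_mul_left J (Nat.le_mul_of_pos_right k hK1)) hprod
  have hkn : k ≤ n := le_trans (Nat.le_mul_of_pos_left k hJ1) hJk
  -- The defining property of `g1 n`, at `l = k`.
  have hω := (g1_isGreatest n hn1).1.2 k hk1 (Nat.ceil_le.2 (not_lt.1 hcon))
  obtain ⟨A, hAsub, hAcard, hA⟩ := exists_subset_largePrimes hJk
  have hblocks := le_card_smallCofactor hα0 hα hδ hJdef hn1 (fun m hm => hM m (hnM.trans hm))
    (show n + k ≤ 2 * n by omega) k n le_rfl rfl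
  rw [← hAcard] at hblocks
  have hlogA : ∀ p ∈ A, Real.log n - Real.log J ≤ Real.log p := by
    intro p hp
    have h1 : (n : ℝ) ≤ J * p := by exact_mod_cast (hA p hp).le
    have hp0 : (p : ℝ) ≠ 0 := by
      rintro h0
      rw [h0] at h1
      linarith
    have h2 := Real.log_le_log hn0 h1
    rw [Real.log_mul hJ0.ne' hp0] at h2
    linarith
  have hlogJ0 : 0 ≤ Real.log J := Real.log_nonneg (by exact_mod_cast hJ1)
  have hlogJ : Real.log J ≤ α * Real.log n + 1 := by
    have h1 := Real.log_le_log hJ0 hJle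
    rw [Real.log_rpow (by rw [h2n]; positivity), h2n,
      Real.log_mul (by norm_num) hn0.ne'] at h1
    nlinarith [Real.log_two_lt_d9, Real.log_two_gt_d9]
  have hlogkKJ : Real.log k + Real.log K ≤ Real.log n - Real.log J := by
    have h1 := Real.log_le_log (by positivity) hprodR
    rw [Real.log_mul hJ0.ne' (by positivity), Real.log_mul hk0.ne' hK0.ne'] at h1
    linarith
  have hlogk : γ * Real.log n ≤ Real.log k := by
    rw [← Real.log_rpow hn0]
    exact Real.log_le_log (by positivity) hkγ
  have hc : (k : ℝ) ≤ Nat.primeCounting k + (largePrimes n k).card := by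
    exact_mod_cast hω.trans (cardDistinctFactors_prod_le n k)
  have hπ : (Nat.primeCounting k : ℝ) + Nat.primeCounting (K * k) ≤ (1 - δ) / 2 * k := by
    have h1 : (1 - δ) / 4 / K * ((K * k : ℕ) : ℝ) = (1 - δ) / 4 * k := by
      push_cast
      field_simp
    rw [h1] at hπ3
    linarith
  exact false_of_log_bounds hk0 hδ hδ1 hγ (sum_log_largePrimes_le hk1 hkn)
    (le_sum_log_largePrimes hk1 hK1 hAsub hlogA) hblocks hc hlogkKJ (by linarith)
    (by linarith) hJ0.le hJβ (Real.log_nonneg (by exact_mod_cast hk1))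
    (Real.log_nonneg (by exact_mod_cast hK1)) hπ1 hπ hlogk hL
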